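/- Let $T>0$, let $V$ be a real separable reflexive Banach space and $H$ a real separable Hilbert space, with a continuous, dense and compact embedding $i:V\to H$, so that $V\subset H\subset V^*$ is an evolution triple. Let $U$ be a real reflexive Banach space, $\iota:V\to U$ a continuous linear map, $A:V\to V^*$ an operator and $J:U\to\mathbb R$ a functional. Write $$J^0(x;z)=\limsup_{y\to x,\ \lambda\to 0^+}\frac{J(y+\lambda z)-J(y)}{\lambda},\qquad \partial J(x)=\{\xi\in U^*:\ \langle\xi,z\rangle\le J^0(x;z)\ \text{for all } z\in U\}$$ for the generalized directional derivative and the generalized gradient in the sense of Clarke. Let $M^{2,2}(0,T;V,V^*)=L^2(0,T;V)\cap BV^2(0,T;V^*)$, where $\|w\|^2_{BV^2(0,T;V^*)}$ is the supremum of $\sum_j\|w(b_j)-w(a_j)\|_{V^*}^2$ over all finite partitions of $[0,T]$ into intervals $(a_j,b_j)$. Assume: * $H(A)_1$: $A$ is pseudomonotone; $\|A(v)\|_{V^*}\le a+b\|v\|$ for all $v\in V$, with $a\ge 0$, $b>0$; $\langle A(v),v\rangle\ge\alpha\|v\|^2-\beta\|v\|_H^2$ for all $v\in V$, with $\alpha>0$,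 $\beta\ge0$; and $\langle Au-Av,u-v\rangle\ge m_1\|u-v\|^2-m_2\|u-v\|_H^2$ for all $u,v\in V$, with $m_1\ge0$, $m_2>0$. * $H(J)_1$: $J$ is locally Lipschitz; $\|\xi\|_{U^*}\le c(1+\|u\|_U)$ for all $u\in U$ and $\xi\in\partial J(u)$, with $c>0$; and $\langle\xi-\eta,\iota u-\iota v\rangle\ge -m_3\|\iota u-\iota v\|_U^2$ for all $u,v\in V$, $\xi\in\partial J(\iota u)$ and $\eta\in\partial J(\iota v)$, with $m_3>0$. * $H_0$: $f\in L^2(0,T;V^*)$ and $u_0\in H$. * $H(U)$: $\iota$ is compact, and the map $v\mapsto\iota(v(\cdot))$ from $M^{2,2}(0,T;V,V^*)$ to $L^2(0,T;U)$ is compact. * $H_{aux}$: at least one of the following holds: A) there is a continuous linear map $p:H\to U$ with $p(i(v))=\iota(v)$ for all $v\in V$; B) $\alpha>c\|\iota\|^2$; C) there are $d\ge0$ and $1\le\sigma<2$ with $J^0(u;-u)\le d(1+\|u\|_U^\sigma)$ for all $u\in U$. * $H_{const}$: either A) holds or $m_1\ge m_3\|\iota\|^2$. Then the evolution inclusion $$u'(t)+Au(t)+\iota^*\partial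 J(\iota u(t))\ni f(t)\quad\text{for a.e. } t\in(0,T),\qquad u(0)=u_0,$$ has at most one solution. Here a solution is a $u\in L^2(0,T;V)$ with distributional derivative $u'\in L^2(0,T;V^*)$ whose representative in $C([0,T];H)$ takes the value $u_0$ at $t=0$ and for which there is $\eta\in L^2(0,T;V^*)$ such that $u'(t)+Au(t)+\eta(t)=f(t)$ for a.e. $t\in(0,T)$ and, for a.e. $t\in(0,T)$ and every $v\in V$, $\langle\eta(t),v\rangle\in\{\langle\xi,\iota v\rangle:\xi\in\partial J(\iota u(t))\}$. -/

import Mathlib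

open MeasureTheory Filter Topology Set
open scoped ContDiff ENNReal

noncomputable section

namespace EvolutionInclusion

/-- A real normed space is reflexive if the canonical map into its bidual is onto. -/
def IsReflexive (X : Type*) [NormedAddCommGroup X] [NormedSpace ℝ X] : Prop :=
  Function.Surjective (NormedSpace.inclusionInDoubleDual ℝ X)

section Clarke

variable {X : Type*} [NormedAddCommGroup X] [NormedSpace ℝ X]

/-- Clarke's generalized directional derivative
`j⁰(x; z) = limsup_{y → x, s → 0⁺} (j (y + s z) - j y) / s` (of a locally Lipschitz `j`). -/
def clarkeDeriv (j : X → ℝ) (x z : X) : ℝ :=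
  limsup (fun p : X × ℝ => (j (p.1 + p.2 • z) - j p.1) / p.2) (𝓝 x ×ˢ 𝓝[>] (0 : ℝ))

/-- Clarke's generalized gradient `∂j(x)`. -/
def clarkeSubdiff (j : X → ℝ) (x : X) : Set (StrongDual ℝ X) :=
  {ξ | ∀ y : X, ξ y ≤ clarkeDeriv j x y}

end Clarke

section Pseudomonotone

variable {X : Type*} [NormedAddCommGroup X] [NormedSpace ℝ X]

/-- Weak convergence of a sequence in a normed space. -/
def WeakTendsto (x : ℕ → X) (x₀ : X) : Prop :=
  Tendsto (fun n => toWeakSpace ℝ X (x n)) atTop (𝓝 (toWeakSpace ℝ X x₀))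

/-- Pseudomonotone multifunctions `A : X → 2^{X*}`; upper and lower limits of real sequences are
taken in the extended reals. -/
structure IsPseudomonotone (A : X → Set (StrongDual ℝ X)) : Prop where
  nonempty : ∀ v, (A v).Nonempty
  weaklyCompact : ∀ v, IsCompact (toWeakSpace ℝ (StrongDual ℝ X) '' A v)
  convex : ∀ v, Convex ℝ (A v)
  usc : ∀ F : Submodule ℝ X, FiniteDimensional ℝ F →
    ∀ O : Set (WeakSpace ℝ (StrongDual ℝ X)), IsOpen O →
      IsOpen {v : F | toWeakSpace ℝ (StrongDual ℝ X) '' A (v : X) ⊆ O}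
  liminf_le : ∀ (v : ℕ → X) (v₀ : X) (ζ : ℕ → StrongDual ℝ X),
    WeakTendsto v v₀ → (∀ n, ζ n ∈ A (v n)) →
    limsup (fun n => ((ζ n (v n - v₀) : ℝ) : EReal)) atTop ≤ 0 →
    ∀ y : X, ∃ ζ₀ ∈ A v₀,
      ((ζ₀ (v₀ - y) : ℝ) : EReal) ≤ liminf (fun n => ((ζ n (v n - y) : ℝ) : EReal)) atTop

end Pseudomonotone

/-- Lebesgue measure on the interval `(0, T)`. -/
abbrev timeMeasure (T : ℝ) : Measure ℝ := volume.restrict (Ioo 0 T)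

/-- The Bochner space `L²(0, T; X)`. -/
abbrev L2 (T : ℝ) (X : Type*) [NormedAddCommGroup X] : Type _ := Lp X 2 (timeMeasure T)

/-- The `q`-th power of the seminorm of `BV^q(0, T; Z)` for `q = 2`: the supremum of
`∑ ‖w (b_i) - w (a_i)‖²` over all finite partitions of `[0, T]` into intervals `(a_i, b_i)`. -/
def sqVariation {Z : Type*} [NormedAddCommGroup Z] (T : ℝ) (w : ℝ → Z) : ℝ≥0∞ :=
  ⨆ (n : ℕ) (t : ℕ → ℝ) (_ : Monotone t) (_ : t 0 = 0) (_ : t n = T),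
    ∑ k ∈ Finset.range n, ‖w (t (k + 1)) - w (t k)‖ₑ ^ 2

section Spaces

variable {V H U : Type*} [NormedAddCommGroup V] [NormedSpace ℝ V]
  [NormedAddCommGroup H] [InnerProductSpace ℝ H]
  [NormedAddCommGroup U] [NormedSpace ℝ U]

/-- `(V, H, V*)` is an evolution triple with embedding `i : V → H`, which is dense and compact.
(The embedding `H → V*` is the transpose of `i`.) -/
structure IsEvolutionTriple (i : V →L[ℝ] H) : Prop where
  reflexive : IsReflexive V
  injective : Function.Injective i
  denseRange : DenseRange i
  compact : IsCompactOperator i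

/-- The composed embedding `V ⊂ H ⊂ V*`, `⟨v, w⟩ = (i v, i w)_H`. -/
def toDual (i : V →L[ℝ] H) : V →L[ℝ] StrongDual ℝ V :=
  ((innerSL ℝ : H →L[ℝ] H →L[ℝ] ℝ).bilinearComp i i)

/-- `g ∈ L²(0, T; V*)` is the distributional derivative of `u ∈ L²(0, T; V)`. -/
def HasWeakDeriv (i : V →L[ℝ] H) {T : ℝ} (u : L2 T V) (g : L2 T (StrongDual ℝ V)) : Prop :=
  ∀ φ : ℝ → ℝ, ContDiff ℝ ∞ φ → HasCompactSupport φ → tsupport φ ⊆ Ioo 0 T →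
    ∫ t in Ioo 0 T, deriv φ t • toDual i (u t) = - ∫ t in Ioo 0 T, φ t • g t

/-- `u(0) = u₀`, where `u(0)` is the value at `0` of the representative of `u` in `C([0, T]; H)`. -/
def HasInitialValue (i : V →L[ℝ] H) {T : ℝ} (u : L2 T V) (u₀ : H) : Prop :=
  ∃ w : ℝ → H, ContinuousOn w (Icc 0 T) ∧ (∀ᵐ t ∂timeMeasure T, w t = i (u t)) ∧ w 0 = u₀

/-- A subset of `L²(0, T; V)` that is contained and bounded in
`M^{2,2}(0, T; V, V*) = L²(0, T; V) ∩ BV²(0, T; V*)`. -/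
def IsBoundedInM22 (i : V →L[ℝ] H) {T : ℝ} (S : Set (L2 T V)) : Prop :=
  ∃ C : ℝ, ∀ u ∈ S, ‖u‖ ≤ C ∧ ∃ w : ℝ → StrongDual ℝ V,
    (∀ᵐ t ∂timeMeasure T, w t = toDual i (u t)) ∧ sqVariation T w ≤ ENNReal.ofReal C

/-- `H(A)`. -/
structure HypA (i : V →L[ℝ] H) (A : V → StrongDual ℝ V) (a b α β : ℝ) : Prop where
  a_nonneg : 0 ≤ a
  b_pos : 0 < b
  α_pos : 0 < α
  β_nonneg : 0 ≤ β
  pseudomonotone : IsPseudomonotone (fun v => ({A v} : Set (StrongDual ℝ V)))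
  growth : ∀ v, ‖A v‖ ≤ a + b * ‖v‖
  coercive : ∀ v, α * ‖v‖ ^ 2 - β * ‖i v‖ ^ 2 ≤ A v v

/-- `H(A)₁`: `H(A)` and strong monotonicity up to a term in `H`. -/
structure HypA₁ (i : V →L[ℝ] H) (A : V → StrongDual ℝ V) (a b α β m₁ m₂ : ℝ) : Prop
    extends HypA i A a b α β where
  m₁_nonneg : 0 ≤ m₁
  m₂_pos : 0 < m₂
  monotone : ∀ u v, m₁ * ‖u - v‖ ^ 2 - m₂ * ‖i (u - v)‖ ^ 2 ≤ (A u - A v) (u - v)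

/-- `H(J)`. -/
structure HypJ (J : U → ℝ) (c : ℝ) : Prop where
  c_pos : 0 < c
  locallyLipschitz : LocallyLipschitz J
  growth : ∀ u, ∀ ξ ∈ clarkeSubdiff J u, ‖ξ‖ ≤ c * (1 + ‖u‖)

/-- `H(J)₁`: `H(J)` and relaxed monotonicity of `∂J`, required only at points `ι u`, `ι v` with
`u, v ∈ V`. -/
structure HypJ₁ (ι : V →L[ℝ] U) (J : U → ℝ) (c m₃ : ℝ) : Prop extends HypJ J c where
  m₃_pos : 0 < m₃
  relaxedMonotone : ∀ u v : V, ∀ ξ ∈ clarkeSubdiff J (ι u), ∀ η ∈ clarkeSubdiff J (ι v),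
    - m₃ * ‖ι u - ι v‖ ^ 2 ≤ (ξ - η) (ι u - ι v)

/-- `H(U)`: `ι : V → U` is compact, and so is the Nemytskii mapping
`M^{2,2}(0, T; V, V*) → L²(0, T; U)`, `v ↦ (t ↦ ι (v t))`. -/
structure HypU (i : V →L[ℝ] H) (ι : V →L[ℝ] U) (T : ℝ) : Prop where
  compact : IsCompactOperator ι
  nemytskii_compact : ∀ S : Set (L2 T V), IsBoundedInM22 i S →
    IsCompact (closure ((fun v : L2 T V => ι.compLp v) '' S))

/-- `H_aux` A): `ι` factors through `H`. -/
def HypAuxA (i : V →L[ℝ] H) (ι : V →L[ℝ] U) : Prop :=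
  ∃ p : H →L[ℝ] U, ∀ v, p (i v) = ι v

/-- `H_aux` B). -/
def HypAuxB (ι : V →L[ℝ] U) (α c : ℝ) : Prop := c * ‖ι‖ ^ 2 < α

/-- `H_aux` C). -/
def HypAuxC (J : U → ℝ) : Prop :=
  ∃ d σ : ℝ, 0 ≤ d ∧ 1 ≤ σ ∧ σ < 2 ∧ ∀ u, clarkeDeriv J u (-u) ≤ d * (1 + ‖u‖ ^ σ)

/-- `H_aux`. -/
def HypAux (i : V →L[ℝ] H) (ι : V →L[ℝ] U) (J : U → ℝ) (α c : ℝ) : Prop :=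
  HypAuxA i ι ∨ HypAuxB ι α c ∨ HypAuxC J

/-- `H_const`. -/
def HypConst (i : V →L[ℝ] H) (ι : V →L[ℝ] U) (m₁ m₃ : ℝ) : Prop :=
  HypAuxA i ι ∨ m₃ * ‖ι‖ ^ 2 ≤ m₁

/-- `u` solves `u'(t) + A u(t) + ι* ∂J(ι u(t)) ∋ f(t)` for a.e. `t ∈ (0, T)`, `u(0) = u₀`, in the
space `W = {u ∈ L²(0, T; V) : u' ∈ L²(0, T; V*)}`. -/
def IsSolution (i : V →L[ℝ] H) (ι : V →L[ℝ] U) (A : V → StrongDual ℝ V) (J : U → ℝ) {T : ℝ}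
    (f : L2 T (StrongDual ℝ V)) (u₀ : H) (u : L2 T V) : Prop :=
  ∃ u' : L2 T (StrongDual ℝ V), HasWeakDeriv i u u' ∧ HasInitialValue i u u₀ ∧
    ∃ η : L2 T (StrongDual ℝ V),
      (∀ᵐ t ∂timeMeasure T, u' t + A (u t) + η t = f t) ∧
      (∀ᵐ t ∂timeMeasure T, ∀ v : V, ∃ ξ ∈ clarkeSubdiff J (ι (u t)), η t v = ξ (ι v))

end Spaces

end EvolutionInclusion

end

/-!
For two solutions `u₁`, `u₂` let `w = u₁ - u₂`, with distributional derivative `g` and continuous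
representative `W : [0, T] → H`, `W 0 = 0`. Strong monotonicity of `A` up to a term in `H`, relaxed
monotonicity of `∂J`, and either the factorization of `ι` through `H` or `m₃ ‖ι‖² ≤ m₁`, give
`⟨g t, w t⟩ ≤ K ‖W t‖²` for a.e. `t` (`apply_sub_le_of_inclusion`). With the energy identity
`‖W t‖² = 2 ∫₀ᵗ ⟨g s, w s⟩ ds` (`norm_sq_sub_norm_sq_eq_integral`) and Gronwall's lemma, `W = 0`,
and `w = 0` since `V → H` is injective.

The energy identity is proved by difference quotients. The weak derivative is tested with smoothed
indicator functions of intervals, so that `⟪W b - W a, i v⟫ = ∫ₐᵇ ⟨g r, v⟩ dr`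
(`inner_sub_eq_integral_of_hasWeakDeriv`). For `a = s`, `b = s + h` and `v = w s + w (s + h)` the
left side is `‖W (s + h)‖² - ‖W s‖²`. Integrating over `s ∈ (0, t)`, dividing by `h` and letting `h → 0`
yields the identity, the right side being controlled by the continuity of translations in `L²`
(`continuous_setIntegral_bilin_translate`). No density of smooth functions is needed.
-/

/-! ### An integral form of the Gronwall lemma -/

theorem eq_zero_of_le_mul_integral {q : ℝ → ℝ} {K T : ℝ} (hq : Continuous q)
    (h0 : ∀ t, 0 ≤ q t) (hK : ∀ t ∈ Ico 0 T, q t ≤ K * ∫ s in 0..t, q s) :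
    ∀ t ∈ Ico 0 T, q t = 0 := by
  intro t ht
  have hd : ∀ x, HasDerivAt (fun x => ∫ s in (0 : ℝ)..x, q s) (q x) x := fun x =>
    intervalIntegral.integral_hasDerivAt_right (hq.intervalIntegrable _ _)
      hq.stronglyMeasurable.stronglyMeasurableAtFilter hq.continuousAt
  have hz : ∫ s in (0 : ℝ)..t, q s = 0 := by
    refine eq_zero_of_abs_deriv_le_mul_abs_self_of_eq_zero_right (K := K)
      (f := fun x => ∫ s in (0 : ℝ)..x, q s) (f' := q) (a := 0) (b := t)
      (fun x _ => (hd x).continuousAt.continuousWithinAt)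
      (fun x _ => (hd x).hasDerivWithinAt) (by simp) ?_ t ⟨ht.1, le_rfl⟩
    intro x hx
    have hn : 0 ≤ ∫ s in (0 : ℝ)..x, q s :=
      intervalIntegral.integral_nonneg hx.1 fun s _ => h0 s
    rw [Real.norm_of_nonneg (h0 x), Real.norm_of_nonneg hn]
    exact hK x ⟨hx.1, hx.2.trans ht.2⟩
  have := hK t ht
  rw [hz, mul_zero] at this
  exact le_antisymm this (h0 t)

/-! ### Pairings of translates -/

section Pairing

variable {E F : Type*} [NormedAddCommGroup E] [NormedSpace ℝ E]
  [NormedAddCommGroup F] [NormedSpace ℝ F]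

/-- Joint continuity in the two shifts; this is the continuity of translations in `L²` together with
the continuity of the pairing of `L²` with `L²`. -/
theorem continuous_setIntegral_bilin_translate (B : E →L[ℝ] F →L[ℝ] ℝ) {g : ℝ → E} {w : ℝ → F}
    (hg : MemLp g 2 volume) (hw : MemLp w 2 volume) (S : Set ℝ) :
    Continuous fun p : ℝ × ℝ => ∫ s in S, B (g (s + p.1)) (w (s + p.2)) := by
  let τ : ℝ → C(ℝ, ℝ) := fun r => ⟨fun s => s + r, by fun_prop⟩
  have hτ : Continuous τ :=
    (ContinuousMap.curry ⟨fun p : ℝ × ℝ => p.2 + p.1, by fun_prop⟩).continuous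
  have hm : ∀ r, MeasurePreserving (τ r) (volume : Measure ℝ) volume := fun r =>
    measurePreserving_add_right volume r
  have hc1 : Continuous fun r => Lp.compMeasurePreserving (τ r) (hm r) (hg.toLp g) :=
    continuous_const.compMeasurePreservingLp hτ hm (by norm_num)
  have hc2 : Continuous fun r => Lp.compMeasurePreserving (τ r) (hm r) (hw.toLp w) :=
    continuous_const.compMeasurePreservingLp hτ hm (by norm_num)
  have key : (fun p : ℝ × ℝ => ∫ s in S, B (g (s + p.1)) (w (s + p.2))) = fun p : ℝ × ℝ =>
      B.lpPairing (volume.restrict S) 2 2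
        (LpToLpRestrictCLM ℝ E ℝ volume 2 S
          (Lp.compMeasurePreserving (τ p.1) (hm p.1) (hg.toLp g)))
        (LpToLpRestrictCLM ℝ F ℝ volume 2 S
          (Lp.compMeasurePreserving (τ p.2) (hm p.2) (hw.toLp w))) := by
    funext p
    rw [ContinuousLinearMap.lpPairing_eq_integral]
    refine integral_congr_ae ?_
    filter_upwards [LpToLpRestrictCLM_coeFn ℝ S
        (Lp.compMeasurePreserving (τ p.1) (hm p.1) (hg.toLp g)),
      LpToLpRestrictCLM_coeFn ℝ S (Lp.compMeasurePreserving (τ p.2) (hm p.2) (hw.toLp w)),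
      ae_restrict_of_ae (Lp.coeFn_compMeasurePreserving (hg.toLp g) (hm p.1)),
      ae_restrict_of_ae (Lp.coeFn_compMeasurePreserving (hw.toLp w) (hm p.2)),
      ae_restrict_of_ae ((hm p.1).quasiMeasurePreserving.ae_eq_comp hg.coeFn_toLp),
      ae_restrict_of_ae ((hm p.2).quasiMeasurePreserving.ae_eq_comp hw.coeFn_toLp)]
      with s h1 h2 h3 h4 h5 h6
    rw [h1, h2, h3, h4, h5, h6]
    rfl
  rw [key]
  refine Continuous.clm_apply ?_ ?_
  · exact (B.lpPairing (volume.restrict S) 2 2).continuous.comp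
      ((LpToLpRestrictCLM ℝ E ℝ volume 2 S).continuous.comp (hc1.comp continuous_fst))
  · exact (LpToLpRestrictCLM ℝ F ℝ volume 2 S).continuous.comp (hc2.comp continuous_snd)

theorem setIntegral_swap_bilin_translate (B : E →L[ℝ] F →L[ℝ] ℝ) {g : ℝ → E} {v : ℝ → F}
    (hgm : StronglyMeasurable g) (hvm : StronglyMeasurable v)
    (hg : MemLp g 2 volume) (hv : MemLp v 2 volume) (S I : Set ℝ) (hI : volume I ≠ ⊤) :
    ∫ s in S, ∫ r in I, B (g (s + r)) (v s) = ∫ r in I, ∫ s in S, B (g (s + r)) (v s) := by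
  have hIf : IsFiniteMeasure (volume.restrict I) := ⟨by simpa using hI.lt_top⟩
  have hg2 : Integrable (fun s => ‖g s‖ ^ 2) := hg.integrable_norm_pow (by norm_num)
  have hv2 : Integrable (fun s => ‖v s‖ ^ 2) := hv.integrable_norm_pow (by norm_num)
  have hsm : StronglyMeasurable (fun p : ℝ × ℝ => B (g (p.1 + p.2)) (v p.1)) :=
    B.isBoundedBilinearMap.continuous.comp_stronglyMeasurable
      ((hgm.comp_measurable (measurable_fst.add measurable_snd)).prodMk
        (hvm.comp_measurable measurable_fst))
  have hbd : ∀ r s, ‖B (g (s + r)) (v s)‖ ≤ ‖B‖ * (‖g (s + r)‖ ^ 2 + ‖v s‖ ^ 2) := by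
    intro r s
    refine (B.le_opNorm₂ _ _).trans ?_
    rw [mul_assoc]
    gcongr
    nlinarith [sq_nonneg (‖g (s + r)‖ - ‖v s‖), sq_nonneg ‖g (s + r)‖, sq_nonneg ‖v s‖]
  have hbi : ∀ r, Integrable (fun s => ‖B‖ * (‖g (s + r)‖ ^ 2 + ‖v s‖ ^ 2)) := fun r =>
    ((hg2.comp_add_right r).add hv2).const_mul _
  refine integral_integral_swap ?_
  refine (integrable_prod_iff' hsm.aestronglyMeasurable).2 ?_
  have hsl : ∀ r, StronglyMeasurable fun s => B (g (s + r)) (v s) := fun r =>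
    hsm.comp_measurable (measurable_id.prodMk measurable_const)
  have hint : ∀ r, Integrable (fun s => B (g (s + r)) (v s)) (volume.restrict S) := fun r =>
    ((hbi r).mono' (hsl r).aestronglyMeasurable (ae_of_all _ (hbd r))).restrict
  refine ⟨ae_of_all _ hint, ?_⟩
  refine Integrable.mono' (g := fun _ => ‖B‖ * ((∫ s, ‖g s‖ ^ 2) + ∫ s, ‖v s‖ ^ 2))
    (integrable_const _) hsm.norm.integral_prod_left'.aestronglyMeasurable (ae_of_all _ fun r => ?_)
  rw [Real.norm_of_nonneg (integral_nonneg fun _ => norm_nonneg _)]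
  calc ∫ s in S, ‖B (g (s + r)) (v s)‖
      ≤ ∫ s in S, ‖B‖ * (‖g (s + r)‖ ^ 2 + ‖v s‖ ^ 2) :=
        integral_mono (hint r).norm (hbi r).restrict (hbd r)
    _ ≤ ∫ s, ‖B‖ * (‖g (s + r)‖ ^ 2 + ‖v s‖ ^ 2) :=
        setIntegral_le_integral (hbi r) (ae_of_all _ fun s => by positivity)
    _ = ‖B‖ * ((∫ s, ‖g s‖ ^ 2) + ∫ s, ‖v s‖ ^ 2) := by
        rw [integral_const_mul, integral_add (hg2.comp_add_right r) hv2,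
          integral_add_right_eq_self (fun s => ‖g s‖ ^ 2) r]

end Pairing

/-! ### Continuous functions with an integrable weak derivative -/

theorem deriv_smoothTransition_of_notMem {x : ℝ} (hx : x ∉ Icc (0 : ℝ) 1) :
    deriv Real.smoothTransition x = 0 := by
  rw [mem_Icc, not_and_or, not_le, not_le] at hx
  rcases hx with hx | hx
  · have : Real.smoothTransition =ᶠ[𝓝 x] fun _ => (0 : ℝ) := by
      filter_upwards [Iio_mem_nhds hx] with y hy
      exact Real.smoothTransition.zero_of_nonpos (le_of_lt hy)
    rw [this.deriv_eq]; simp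
  · have : Real.smoothTransition =ᶠ[𝓝 x] fun _ => (1 : ℝ) := by
      filter_upwards [Ioi_mem_nhds hx] with y hy
      exact Real.smoothTransition.one_of_one_le (le_of_lt hy)
    rw [this.deriv_eq]; simp

theorem continuous_deriv_smoothTransition : Continuous (deriv Real.smoothTransition) :=
  (Real.smoothTransition.contDiff (n := 1)).continuous_deriv le_rfl

theorem hasDerivAt_smoothTransition_scaled (a ε t : ℝ) :
    HasDerivAt (fun t => Real.smoothTransition ((t - a) / ε))
      (deriv Real.smoothTransition ((t - a) / ε) * (1 / ε)) t := by
  have h1 : HasDerivAt Real.smoothTransition (deriv Real.smoothTransition ((t - a) / ε))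
      ((t - a) / ε) :=
    ((Real.smoothTransition.contDiff (n := 1)).differentiable (by norm_num) _).hasDerivAt
  exact h1.comp t (((hasDerivAt_id t).sub_const a).div_const ε)

theorem setIntegral_deriv_smoothTransition_scaled {q : ℝ → ℝ} {T a ε : ℝ}
    (ha : 0 < a) (hε : 0 < ε) (hb : a + ε < T) :
    ∫ t in Ioo 0 T, (deriv Real.smoothTransition ((t - a) / ε) * (1 / ε)) * q t =
      ∫ x in (0 : ℝ)..1, deriv Real.smoothTransition x * q (a + ε * x) := by
  have h1 : ∫ t in Ioo 0 T, (deriv Real.smoothTransition ((t - a) / ε) * (1 / ε)) * q t =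
      ∫ t in Icc a (a + ε), (deriv Real.smoothTransition ((t - a) / ε) * (1 / ε)) * q t := by
    refine setIntegral_eq_of_subset_of_forall_sdiff_eq_zero measurableSet_Ioo
      (fun t ht => ⟨ha.trans_le ht.1, ht.2.trans_lt hb⟩) fun t ht => ?_
    rw [deriv_smoothTransition_of_notMem, zero_mul, zero_mul]
    rintro ⟨h0, h1⟩
    rw [le_div_iff₀ hε] at h0
    rw [div_le_iff₀ hε] at h1
    exact ht.2 ⟨by linarith, by linarith⟩
  rw [h1, integral_Icc_eq_integral_Ioc, ← intervalIntegral.integral_of_le (by linarith)]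
  have h2 := intervalIntegral.smul_integral_comp_add_mul (a := 0) (b := 1)
    (fun t => (deriv Real.smoothTransition ((t - a) / ε) * (1 / ε)) * q t) ε a
  simp only [mul_zero, add_zero, mul_one] at h2
  rw [← h2, smul_eq_mul, ← intervalIntegral.integral_const_mul]
  refine intervalIntegral.integral_congr fun x _ => ?_
  have : (a + ε * x - a) / ε = x := by field_simp; ring
  simp only [this]
  field_simp

/-- A continuous function with weak derivative `k` on `(0, T)` is an antiderivative of `k`. The test
functions `S ((t - a) / ε) - S ((t - b) / ε)`, with `S` the smooth transition from `0` to `1`,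
converge to the indicator function of `(a, b]` as `ε → 0⁺`, and their derivatives to the difference
of the point masses at `a` and `b`. -/
theorem sub_eq_integral_of_weak_deriv {q k : ℝ → ℝ} {T a b : ℝ} (hq : Continuous q)
    (hk : IntegrableOn k (Ioo 0 T))
    (h : ∀ φ : ℝ → ℝ, ContDiff ℝ ∞ φ → HasCompactSupport φ → tsupport φ ⊆ Ioo 0 T →
      ∫ t in Ioo 0 T, deriv φ t * q t = - ∫ t in Ioo 0 T, φ t * k t)
    (ha : 0 < a) (hab : a ≤ b) (hb : b < T) :
    q b - q a = ∫ t in a..b, k t := by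
  let S := Real.smoothTransition
  let φ : ℝ → ℝ → ℝ := fun ε t => S ((t - a) / ε) - S ((t - b) / ε)
  let Q : ℝ → ℝ → ℝ := fun a ε => ∫ x in (0 : ℝ)..1, deriv S x * q (a + ε * x)
  have hQc : ∀ a, Continuous (Q a) := fun a => by
    refine intervalIntegral.continuous_parametric_intervalIntegral_of_continuous' ?_ 0 1
    exact (continuous_deriv_smoothTransition.comp continuous_snd).mul
      (hq.comp (by fun_prop))
  have hQ0 : ∀ a, Q a 0 = q a := fun a => by
    simp only [Q, zero_mul, add_zero]
    rw [intervalIntegral.integral_mul_const, intervalIntegral.integral_deriv_eq_sub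
      (fun x _ => ((Real.smoothTransition.contDiff (n := 1)).differentiable (by norm_num) x))
      (continuous_deriv_smoothTransition.intervalIntegrable _ _)]
    simp
  have hlim1 : Tendsto (fun ε => Q a ε - Q b ε) (𝓝[>] 0) (𝓝 (q a - q b)) := by
    have := (((hQc a).sub (hQc b)).tendsto 0).mono_left (nhdsWithin_le_nhds (s := Ioi 0))
    rw [Pi.sub_apply, hQ0, hQ0] at this
    exact this
  have hlim2 : Tendsto (fun ε => - ∫ t in Ioo 0 T, φ ε t * k t) (𝓝[>] 0)
      (𝓝 (- ∫ t in a..b, k t)) := by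
    refine Tendsto.neg ?_
    have hsub : Ioc a b ⊆ Ioo 0 T := fun t ht => ⟨ha.trans ht.1, ht.2.trans_lt hb⟩
    have e : ∫ t in a..b, k t = ∫ t in Ioo 0 T, (Ioc a b).indicator k t := by
      rw [intervalIntegral.integral_of_le hab, setIntegral_indicator measurableSet_Ioc,
        inter_eq_self_of_subset_right hsub]
    rw [e]
    have hSc : Continuous S := Real.smoothTransition.continuous
    refine tendsto_integral_filter_of_dominated_convergence (fun t => ‖k t‖) ?_ ?_ hk.norm ?_
    · refine Eventually.of_forall fun ε => ?_
      refine Continuous.aestronglyMeasurable ?_ |>.mul hk.aestronglyMeasurable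
      exact (hSc.comp (by fun_prop)).sub (hSc.comp (by fun_prop))
    · refine Eventually.of_forall fun ε => ae_of_all _ fun t => ?_
      rw [norm_mul]
      refine mul_le_of_le_one_left (norm_nonneg _) ?_
      rw [Real.norm_eq_abs, abs_le]
      have a1 := Real.smoothTransition.nonneg ((t - a) / ε)
      have a2 := Real.smoothTransition.le_one ((t - a) / ε)
      have b1 := Real.smoothTransition.nonneg ((t - b) / ε)
      have b2 := Real.smoothTransition.le_one ((t - b) / ε)
      constructor <;> simp only [φ, S] <;> linarith
    · refine ae_of_all _ fun t => ?_
      have hev1 : ∀ d, d < t → ∀ᶠ ε in 𝓝[>] (0 : ℝ), S ((t - d) / ε) = 1 := by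
        intro d hd
        filter_upwards [Ioo_mem_nhdsGT (sub_pos.2 hd)] with ε hε
        exact Real.smoothTransition.one_of_one_le ((one_le_div hε.1).2 hε.2.le)
      have hev0 : ∀ d, t ≤ d → ∀ᶠ ε in 𝓝[>] (0 : ℝ), S ((t - d) / ε) = 0 := by
        intro d hd
        filter_upwards [self_mem_nhdsWithin] with ε hε
        exact Real.smoothTransition.zero_of_nonpos
          (div_nonpos_of_nonpos_of_nonneg (by linarith) (le_of_lt hε))
      refine tendsto_const_nhds.congr' ?_
      rcases le_or_gt t a with h1 | h1
      · filter_upwards [hev0 a h1, hev0 b (h1.trans hab)] with ε e1 e2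
        simp [φ, e1, e2, indicator, h1]
      · rcases le_or_gt t b with h2 | h2
        · filter_upwards [hev1 a h1, hev0 b h2] with ε e1 e2
          simp [φ, e1, e2, indicator, h1, h2]
        · filter_upwards [hev1 a h1, hev1 b h2] with ε e1 e2
          simp [φ, e1, e2, indicator, h2.not_ge]
  have hev : (fun ε => Q a ε - Q b ε) =ᶠ[𝓝[>] 0] fun ε => - ∫ t in Ioo 0 T, φ ε t * k t := by
    filter_upwards [Ioo_mem_nhdsGT (sub_pos.2 hb)] with ε hε
    have hεT : b + ε < T := by linarith [hε.2]
    have hzero : ∀ t, t ∉ Icc a (b + ε) → φ ε t = 0 := by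
      intro t ht
      rw [mem_Icc, not_and_or, not_le, not_le] at ht
      simp only [φ, S]
      rcases ht with ht | ht
      · rw [Real.smoothTransition.zero_of_nonpos, Real.smoothTransition.zero_of_nonpos, sub_zero] <;>
        exact div_nonpos_of_nonpos_of_nonneg (by linarith) hε.1.le
      · rw [Real.smoothTransition.one_of_one_le, Real.smoothTransition.one_of_one_le, sub_self] <;>
        exact (one_le_div hε.1).2 (by linarith)
    have hsupp : tsupport (φ ε) ⊆ Icc a (b + ε) :=
      closure_minimal (fun t ht => by_contra fun hn => ht (hzero t hn)) isClosed_Icc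
    have hsm : ContDiff ℝ ∞ (φ ε) :=
      (Real.smoothTransition.contDiff.comp (by fun_prop)).sub
        (Real.smoothTransition.contDiff.comp (by fun_prop))
    rw [← h (φ ε) hsm (HasCompactSupport.of_support_subset_isCompact isCompact_Icc
      (subset_closure.trans hsupp))
      (hsupp.trans fun t ht => ⟨ha.trans_le ht.1, ht.2.trans_lt hεT⟩)]
    simp only [Q, S]
    rw [← setIntegral_deriv_smoothTransition_scaled ha hε.1 (by linarith : a + ε < T),
      ← setIntegral_deriv_smoothTransition_scaled (ha.trans_le hab) hε.1 hεT, ← integral_sub]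
    · refine integral_congr_ae (ae_of_all _ fun t => ?_)
      have hd := ((hasDerivAt_smoothTransition_scaled a ε t).sub
        (hasDerivAt_smoothTransition_scaled b ε t)).deriv
      have : deriv (φ ε) t = _ := hd
      simp only [this]
      ring
    all_goals
      refine (Continuous.integrableOn_Icc ?_).mono_set Ioo_subset_Icc_self
      exact ((continuous_deriv_smoothTransition.comp (by fun_prop)).mul continuous_const).mul hq
  have := tendsto_nhds_unique (hlim1.congr' hev) hlim2
  linarith

/-! ### The energy identity and weak derivatives in `V*` -/

/-- The Lions–Magenes energy identity for a continuous `H`-valued function `W` that agrees a.e. with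
`i ∘ w`, `w ∈ L²(V)`, and whose increments are those of an antiderivative of `g ∈ L²(V*)`. -/
theorem norm_sq_sub_norm_sq_eq_integral {V H : Type*} [NormedAddCommGroup V] [NormedSpace ℝ V]
    [NormedAddCommGroup H] [InnerProductSpace ℝ H] (i : V →L[ℝ] H) {T : ℝ} {W : ℝ → H}
    {w : ℝ → V} {g : ℝ → StrongDual ℝ V} (hW : Continuous W)
    (hwm : StronglyMeasurable w) (hgm : StronglyMeasurable g)
    (hw : MemLp w 2 volume) (hg : MemLp g 2 volume)
    (hWw : ∀ᵐ s, s ∈ Ioo 0 T → W s = i (w s))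
    (hinc : ∀ a b : ℝ, 0 < a → a ≤ b → b < T → ∀ v : V,
      inner ℝ (W b - W a) (i v) = ∫ r in a..b, g r v)
    {t : ℝ} (ht : t ∈ Ico 0 T) :
    ‖W t‖ ^ 2 - ‖W 0‖ ^ 2 = 2 * ∫ s in 0..t, g s (w s) := by
  let B : StrongDual ℝ V →L[ℝ] V →L[ℝ] ℝ := ContinuousLinearMap.id ℝ (StrongDual ℝ V)
  let q : ℝ → ℝ := fun s => ‖W s‖ ^ 2
  have hq : Continuous q := hW.norm.pow 2
  let P : ℝ × ℝ → ℝ := fun p => ∫ s in Ioc 0 t, B (g (s + p.1)) (w (s + p.2))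
  have hP : Continuous P := continuous_setIntegral_bilin_translate B hg hw _
  -- `L h` and `R h` are `1 / h` times the two sides of
  -- `∫₀ᵗ (‖W (s + h)‖² - ‖W s‖²) ds = ∫₀ᵗ ∫₀ʰ ⟨g (s + r), w s + w (s + h)⟩ dr ds`, rescaled to
  -- integrals over `[0, 1]` which make sense and are continuous also at `h = 0`.
  let L : ℝ → ℝ := fun h => ∫ x in (0 : ℝ)..1, (q (t + h * x) - q (0 + h * x))
  let R : ℝ → ℝ := fun h => ∫ x in (0 : ℝ)..1, (P (0 + h * x, 0) + P (0 + h * x, h))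
  have hL : Continuous L :=
    intervalIntegral.continuous_parametric_intervalIntegral_of_continuous'
      ((hq.comp (by fun_prop)).sub (hq.comp (by fun_prop))) 0 1
  have hR : Continuous R :=
    intervalIntegral.continuous_parametric_intervalIntegral_of_continuous'
      ((hP.comp (by fun_prop)).add (hP.comp (by fun_prop))) 0 1
  have hqi : ∀ a b, IntervalIntegrable q volume a b := fun a b => hq.intervalIntegrable a b
  have hLR : L =ᶠ[𝓝[>] 0] R := by
    filter_upwards [Ioo_mem_nhdsGT (sub_pos.2 ht.2)] with h hh
    have hth : t + h < T := by linarith [hh.2]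
    have e1 : h * L h = ∫ s in 0..t, (q (s + h) - q s) := by
      have a1 := intervalIntegral.smul_integral_comp_add_mul (a := 0) (b := 1) q h t
      have a2 := intervalIntegral.smul_integral_comp_add_mul (a := 0) (b := 1) q h 0
      simp only [mul_zero, mul_one, smul_eq_mul, add_zero] at a1 a2
      simp only [L]
      have b1 : IntervalIntegrable (fun x => q (t + h * x)) volume 0 1 :=
        (hq.comp (by fun_prop)).intervalIntegrable _ _
      have b2 : IntervalIntegrable (fun x => q (0 + h * x)) volume 0 1 :=
        (hq.comp (by fun_prop)).intervalIntegrable _ _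
      have b3 : IntervalIntegrable (fun x => q (x + h)) volume 0 t :=
        (hq.comp (by fun_prop)).intervalIntegrable _ _
      rw [intervalIntegral.integral_sub b1 b2, mul_sub, a1, a2,
        intervalIntegral.integral_sub b3 (hqi _ _),
        intervalIntegral.integral_comp_add_right q h, zero_add]
      have c1 := intervalIntegral.integral_add_adjacent_intervals (hqi 0 t) (hqi t (t + h))
      have c2 := intervalIntegral.integral_add_adjacent_intervals (hqi 0 h) (hqi h (t + h))
      linarith
    have e2 : ∫ s in 0..t, (q (s + h) - q s) =
        ∫ s in Ioc 0 t, ∫ r in Ioc 0 h, B (g (s + r)) (w s + w (s + h)) := by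
      rw [intervalIntegral.integral_of_le ht.1]
      refine setIntegral_congr_ae measurableSet_Ioc ?_
      filter_upwards [hWw, (measurePreserving_add_right volume h).quasiMeasurePreserving.ae hWw]
        with s h1 h2 hs
      have h1 := h1 ⟨hs.1, hs.2.trans_lt ht.2⟩
      have h2 := h2 ⟨by linarith [hs.1, hh.1], by linarith [hs.2]⟩
      -- Testing the increment with `w s + w (s + h)` produces a difference of squares.
      have h3 := hinc s (s + h) hs.1 (by linarith [hh.1]) (by linarith [hs.2]) (w s + w (s + h))
      rw [← intervalIntegral.integral_of_le hh.1.le,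
        intervalIntegral.integral_comp_add_left (fun r => B (g r) (w s + w (s + h))) s, add_zero]
      change _ = ∫ r in s..(s + h), (g r) (w s + w (s + h))
      rw [← h3, map_add, ← h1, ← h2, inner_sub_left, inner_add_right, inner_add_right,
        real_inner_self_eq_norm_sq, real_inner_self_eq_norm_sq, real_inner_comm (W s) (W (s + h))]
      simp only [q]
      ring
    have hsh : MemLp (fun s => w (s + h)) 2 volume :=
      hw.comp_measurePreserving (measurePreserving_add_right volume h)
    have hshm : StronglyMeasurable fun s => w (s + h) :=
      hwm.comp_measurable (measurable_id.add_const h)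
    have e3 : ∫ s in Ioc 0 t, ∫ r in Ioc 0 h, B (g (s + r)) (w s + w (s + h)) =
        ∫ r in 0..h, (P (r, 0) + P (r, h)) := by
      rw [setIntegral_swap_bilin_translate B (v := fun s => w s + w (s + h)) hgm (hwm.add hshm) hg
        (hw.add hsh) _ _ (by simp), intervalIntegral.integral_of_le hh.1.le]
      refine integral_congr_ae (ae_of_all _ fun r => ?_)
      have hgr : MemLp (fun s => g (s + r)) 2 volume :=
        hg.comp_measurePreserving (measurePreserving_add_right volume r)
      simp only [P, map_add, add_zero]
      refine integral_add ?_ ?_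
      · exact (memLp_one_iff_integrable.1 (B.memLp_of_bilin 1 hgr hw)).restrict
      · exact (memLp_one_iff_integrable.1 (B.memLp_of_bilin 1 hgr hsh)).restrict
    have e4 : ∫ r in 0..h, (P (r, 0) + P (r, h)) = h * R h := by
      have := intervalIntegral.smul_integral_comp_add_mul (a := 0) (b := 1)
        (fun r => P (r, 0) + P (r, h)) h 0
      simp only [mul_zero, mul_one, smul_eq_mul, zero_add] at this
      simp only [R, zero_add, this]
    exact mul_left_cancel₀ hh.1.ne' (e1.trans (e2.trans (e3.trans e4)))
  -- Both sides are continuous and agree for small `h > 0`, hence agree at `h = 0`.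
  have hlim := tendsto_nhds_unique
    (((hL.tendsto 0).mono_left nhdsWithin_le_nhds).congr' hLR)
    ((hR.tendsto 0).mono_left nhdsWithin_le_nhds)
  simp only [L, R, zero_mul, add_zero, intervalIntegral.integral_const, sub_zero, one_smul,
    P, q, B] at hlim
  rw [hlim, intervalIntegral.integral_of_le ht.1, two_mul]
  rfl

/-- The continuous representative `W` of `u` is an antiderivative of the distributional derivative
`g`, in the sense of `V*`: this reduces to the scalar case by evaluating at a fixed `v`. -/
theorem inner_sub_eq_integral_of_hasWeakDeriv {V H : Type*} [NormedAddCommGroup V]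
    [NormedSpace ℝ V] [NormedAddCommGroup H] [InnerProductSpace ℝ H] {i : V →L[ℝ] H} {T : ℝ}
    {u : EvolutionInclusion.L2 T V} {g : EvolutionInclusion.L2 T (StrongDual ℝ V)}
    (hg : EvolutionInclusion.HasWeakDeriv i u g) {W : ℝ → H} (hW : Continuous W)
    (hWu : ∀ᵐ t ∂EvolutionInclusion.timeMeasure T, W t = i (u t))
    {a b : ℝ} (ha : 0 < a) (hab : a ≤ b) (hb : b < T) (v : V) :
    inner ℝ (W b - W a) (i v) = ∫ r in a..b, g r v := by
  have hgi : Integrable g (EvolutionInclusion.timeMeasure T) :=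
    (Lp.memLp g).integrable (by norm_num)
  have hui : Integrable u (EvolutionInclusion.timeMeasure T) :=
    (Lp.memLp u).integrable (by norm_num)
  have hq : Continuous fun t => inner ℝ (W t) (i v) := hW.inner continuous_const
  rw [inner_sub_left]
  refine sub_eq_integral_of_weak_deriv (T := T) hq (hgi.apply_continuousLinearMap v) ?_ ha hab hb
  intro φ hφ hc hs
  have h := congrArg (fun L : StrongDual ℝ V => L v) (hg φ hφ hc hs)
  have hφ' : Continuous (deriv φ) := hφ.continuous_deriv (by simp)
  obtain ⟨C, hC⟩ := hφ.continuous.bounded_above_of_compact_support hc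
  obtain ⟨D, hD⟩ := hφ'.bounded_above_of_compact_support hc.deriv
  have i1 : Integrable (fun t => φ t • g t) (EvolutionInclusion.timeMeasure T) :=
    hgi.bdd_smul C hφ.continuous.aestronglyMeasurable (ae_of_all _ hC)
  have i2 : Integrable (fun t => deriv φ t • EvolutionInclusion.toDual i (u t))
      (EvolutionInclusion.timeMeasure T) :=
    ((EvolutionInclusion.toDual i).integrable_comp hui).bdd_smul D hφ'.aestronglyMeasurable
      (ae_of_all _ hD)
  simp only [neg_apply] at h
  rw [ContinuousLinearMap.integral_apply i1, ContinuousLinearMap.integral_apply i2] at h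
  refine Eq.trans (integral_congr_ae ?_) h
  filter_upwards [hWu] with t ht
  simp [EvolutionInclusion.toDual, ht]

/-! ### Monotonicity of the inclusion -/

/-- One-sided Lipschitz estimate in the norm of `H` for the difference of two solutions at a fixed
time, `g₁` and `g₂` standing for the values of the derivatives. The relaxed monotonicity constant
`m₃` is absorbed either in `H`, when `ι` factors through `H`, or by the strong monotonicity constant
`m₁` of `A`. -/
theorem apply_sub_le_of_inclusion {V H U : Type*}
    [NormedAddCommGroup V] [NormedSpace ℝ V] [NormedAddCommGroup H] [InnerProductSpace ℝ H]
    [NormedAddCommGroup U] [NormedSpace ℝ U]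
    {i : V →L[ℝ] H} {ι : V →L[ℝ] U} {A : V → StrongDual ℝ V} {J : U → ℝ}
    {a b α β c m₁ m₂ m₃ : ℝ}
    (hA₁ : EvolutionInclusion.HypA₁ i A a b α β m₁ m₂) (hJ₁ : EvolutionInclusion.HypJ₁ ι J c m₃)
    (hconst : EvolutionInclusion.HypConst i ι m₁ m₃) :
    ∃ K : ℝ, 0 ≤ K ∧ ∀ (x y : V) (g₁ g₂ η₁ η₂ f : StrongDual ℝ V),
      g₁ + A x + η₁ = f → g₂ + A y + η₂ = f →
      (∀ v : V, ∃ ξ ∈ EvolutionInclusion.clarkeSubdiff J (ι x), η₁ v = ξ (ι v)) →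
      (∀ v : V, ∃ ξ ∈ EvolutionInclusion.clarkeSubdiff J (ι y), η₂ v = ξ (ι v)) →
      (g₁ - g₂) (x - y) ≤ K * ‖i (x - y)‖ ^ 2 := by
  have key : ∀ (x y : V) (g₁ g₂ η₁ η₂ f : StrongDual ℝ V),
      g₁ + A x + η₁ = f → g₂ + A y + η₂ = f →
      (∀ v : V, ∃ ξ ∈ EvolutionInclusion.clarkeSubdiff J (ι x), η₁ v = ξ (ι v)) →
      (∀ v : V, ∃ ξ ∈ EvolutionInclusion.clarkeSubdiff J (ι y), η₂ v = ξ (ι v)) →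
      (g₁ - g₂) (x - y) ≤ m₂ * ‖i (x - y)‖ ^ 2 - m₁ * ‖x - y‖ ^ 2 + m₃ * ‖ι (x - y)‖ ^ 2 := by
    intro x y g₁ g₂ η₁ η₂ f h₁ h₂ hη₁ hη₂
    -- `ξ₁` and `ξ₂` may depend on the direction; only the direction `x - y` is needed.
    obtain ⟨ξ₁, hξ₁, e₁⟩ := hη₁ (x - y)
    obtain ⟨ξ₂, hξ₂, e₂⟩ := hη₂ (x - y)
    have hJ := hJ₁.relaxedMonotone x y ξ₁ hξ₁ ξ₂ hξ₂
    have hA := hA₁.monotone x y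
    rw [← map_sub, sub_apply, ← e₁, ← e₂] at hJ
    have e : g₁ - g₂ = -(A x - A y) - (η₁ - η₂) := by
      rw [eq_sub_of_add_eq (eq_sub_of_add_eq h₁), eq_sub_of_add_eq (eq_sub_of_add_eq h₂)]
      abel
    rw [e]
    simp only [sub_apply, neg_apply] at hA ⊢
    linarith
  rcases hconst with ⟨p, hp⟩ | hm
  · refine ⟨m₂ + m₃ * ‖p‖ ^ 2, by have := hA₁.m₂_pos; have := hJ₁.m₃_pos; positivity, ?_⟩
    intro x y g₁ g₂ η₁ η₂ f h₁ h₂ hη₁ hη₂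
    have h := key x y g₁ g₂ η₁ η₂ f h₁ h₂ hη₁ hη₂
    have hn : m₃ * ‖ι (x - y)‖ ^ 2 ≤ m₃ * (‖p‖ * ‖i (x - y)‖) ^ 2 := by
      have := hJ₁.m₃_pos
      rw [← hp]
      gcongr
      exact p.le_opNorm _
    have : 0 ≤ m₁ * ‖x - y‖ ^ 2 := mul_nonneg hA₁.m₁_nonneg (sq_nonneg _)
    linarith
  · refine ⟨m₂, hA₁.m₂_pos.le, ?_⟩
    intro x y g₁ g₂ η₁ η₂ f h₁ h₂ hη₁ hη₂
    have h := key x y g₁ g₂ η₁ η₂ f h₁ h₂ hη₁ hη₂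
    have hn : m₃ * ‖ι (x - y)‖ ^ 2 ≤ m₃ * (‖ι‖ * ‖x - y‖) ^ 2 := by
      have := hJ₁.m₃_pos
      gcongr
      exact ι.le_opNorm _
    have : m₃ * ‖ι‖ ^ 2 * ‖x - y‖ ^ 2 ≤ m₁ * ‖x - y‖ ^ 2 :=
      mul_le_mul_of_nonneg_right hm (sq_nonneg _)
    linarith

/-! ### Uniqueness -/

theorem EvolutionInclusion.HasInitialValue.exists_continuous {V H : Type*} [NormedAddCommGroup V]
    [NormedSpace ℝ V] [NormedAddCommGroup H] [InnerProductSpace ℝ H] {i : V →L[ℝ] H} {T : ℝ}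
    (hT : 0 < T) {u : EvolutionInclusion.L2 T V} {u₀ : H}
    (h : EvolutionInclusion.HasInitialValue i u u₀) :
    ∃ W : ℝ → H, Continuous W ∧
      (∀ᵐ t ∂EvolutionInclusion.timeMeasure T, W t = i (u t)) ∧ W 0 = u₀ := by
  obtain ⟨w, hw, hwu, hw0⟩ := h
  refine ⟨IccExtend hT.le ((Icc 0 T).domRestrict w), hw.domRestrict.Icc_extend', ?_, ?_⟩
  · filter_upwards [hwu, ae_restrict_mem measurableSet_Ioo] with t ht htm
    rw [IccExtend_of_mem hT.le _ (Ioo_subset_Icc_self htm), domRestrict_apply, ht]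
  · rw [IccExtend_of_mem hT.le _ (left_mem_Icc.2 hT.le), domRestrict_apply, hw0]

theorem mainTheorem2
    {V H U : Type*}
    [NormedAddCommGroup V] [NormedSpace ℝ V] [CompleteSpace V] [TopologicalSpace.SeparableSpace V]
    [NormedAddCommGroup H] [InnerProductSpace ℝ H] [CompleteSpace H]
    [TopologicalSpace.SeparableSpace H]
    [NormedAddCommGroup U] [NormedSpace ℝ U] [CompleteSpace U]
    (T : ℝ) (hT : 0 < T)
    (i : V →L[ℝ] H) (hi : EvolutionInclusion.IsEvolutionTriple i)
    (hU : EvolutionInclusion.IsReflexive U)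
    (ι : V →L[ℝ] U) (A : V → StrongDual ℝ V) (J : U → ℝ)
    (a b α β c m₁ m₂ m₃ : ℝ)
    (hA₁ : EvolutionInclusion.HypA₁ i A a b α β m₁ m₂)
    (hJ₁ : EvolutionInclusion.HypJ₁ ι J c m₃)
    (hHU : EvolutionInclusion.HypU i ι T)
    (haux : EvolutionInclusion.HypAux i ι J α c)
    (hconst : EvolutionInclusion.HypConst i ι m₁ m₃)
    (f : EvolutionInclusion.L2 T (StrongDual ℝ V)) (u₀ : H)
    (u₁ u₂ : EvolutionInclusion.L2 T V)
    (hu₁ : EvolutionInclusion.IsSolution i ι A J f u₀ u₁)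
    (hu₂ : EvolutionInclusion.IsSolution i ι A J f u₀ u₂) :
    u₁ = u₂ := by
  obtain ⟨g₁, hg₁, hin₁, η₁, heq₁, hη₁⟩ := hu₁
  obtain ⟨g₂, hg₂, hin₂, η₂, heq₂, hη₂⟩ := hu₂
  obtain ⟨W₁, hW₁, hWu₁, hW₁0⟩ := hin₁.exists_continuous hT
  obtain ⟨W₂, hW₂, hWu₂, hW₂0⟩ := hin₂.exists_continuous hT
  obtain ⟨K, hK0, hK⟩ := apply_sub_le_of_inclusion hA₁ hJ₁ hconst
  let W : ℝ → H := fun t => W₁ t - W₂ t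
  have hW : Continuous W := hW₁.sub hW₂
  have hW0 : W 0 = 0 := by simp only [W, hW₁0, hW₂0, sub_self]
  -- Extension by zero to the real line makes translations in time available.
  let w : ℝ → V := (Ioo 0 T).indicator fun t => u₁ t - u₂ t
  let g : ℝ → StrongDual ℝ V := (Ioo 0 T).indicator fun t => g₁ t - g₂ t
  have hwm : StronglyMeasurable w :=
    ((Lp.stronglyMeasurable u₁).sub (Lp.stronglyMeasurable u₂)).indicator measurableSet_Ioo
  have hgm : StronglyMeasurable g :=
    ((Lp.stronglyMeasurable g₁).sub (Lp.stronglyMeasurable g₂)).indicator measurableSet_Ioo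
  have hw : MemLp w 2 volume :=
    (memLp_indicator_iff_restrict measurableSet_Ioo).2 ((Lp.memLp u₁).sub (Lp.memLp u₂))
  have hg : MemLp g 2 volume :=
    (memLp_indicator_iff_restrict measurableSet_Ioo).2 ((Lp.memLp g₁).sub (Lp.memLp g₂))
  have hWw : ∀ᵐ s, s ∈ Ioo 0 T → W s = i (w s) := by
    rw [← ae_restrict_iff' measurableSet_Ioo]
    filter_upwards [hWu₁, hWu₂, ae_restrict_mem measurableSet_Ioo] with s h1 h2 hs
    simp only [W, w, indicator_of_mem hs, h1, h2, map_sub]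
  have hinc : ∀ a b : ℝ, 0 < a → a ≤ b → b < T → ∀ v : V,
      inner ℝ (W b - W a) (i v) = ∫ r in a..b, g r v := by
    intro a b ha hab hb v
    have hsub : Ioc a b ⊆ Ioo 0 T := fun t ht => ⟨ha.trans ht.1, ht.2.trans_lt hb⟩
    have hint : ∀ k : EvolutionInclusion.L2 T (StrongDual ℝ V),
        IntervalIntegrable (fun r => k r v) volume a b := fun k => by
      rw [intervalIntegrable_iff_integrableOn_Ioc_of_le hab]
      have hk : IntegrableOn k (Ioo 0 T) := (Lp.memLp k).integrable (by norm_num)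
      exact (hk.mono_set hsub).apply_continuousLinearMap v
    have e : W b - W a = (W₁ b - W₁ a) - (W₂ b - W₂ a) := by simp only [W]; abel
    rw [e, inner_sub_left, inner_sub_eq_integral_of_hasWeakDeriv hg₁ hW₁ hWu₁ ha hab hb,
      inner_sub_eq_integral_of_hasWeakDeriv hg₂ hW₂ hWu₂ ha hab hb,
      ← intervalIntegral.integral_sub (hint g₁) (hint g₂), intervalIntegral.integral_of_le hab,
      intervalIntegral.integral_of_le hab]
    refine setIntegral_congr_fun measurableSet_Ioc fun r hr => ?_
    simp only [g, indicator_of_mem (hsub hr), sub_apply]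
  have hle : ∀ᵐ s, s ∈ Ioo 0 T → g s (w s) ≤ K * ‖W s‖ ^ 2 := by
    have hWw' := (ae_restrict_iff' measurableSet_Ioo).2 hWw
    rw [← ae_restrict_iff' measurableSet_Ioo]
    filter_upwards [hWw', heq₁, heq₂, hη₁, hη₂, ae_restrict_mem measurableSet_Ioo]
      with s h1 h2 h3 h4 h5 hs
    rw [h1]
    simp only [g, w, indicator_of_mem hs]
    exact hK _ _ _ _ _ _ _ h2 h3 h4 h5
  -- Energy identity and Gronwall.
  have hzero : ∀ t ∈ Ico 0 T, ‖W t‖ ^ 2 = 0 := by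
    have hq : Continuous fun t => ‖W t‖ ^ 2 := hW.norm.pow 2
    refine eq_zero_of_le_mul_integral (K := 2 * K) hq (fun t => sq_nonneg ‖W t‖) fun t ht => ?_
    have hE := norm_sq_sub_norm_sq_eq_integral i hW hwm hgm hw hg hWw hinc ht
    rw [hW0, norm_zero, zero_pow two_ne_zero, sub_zero] at hE
    rw [hE, mul_assoc, ← intervalIntegral.integral_const_mul K]
    refine mul_le_mul_of_nonneg_left ?_ zero_le_two
    rw [intervalIntegral.integral_of_le ht.1, intervalIntegral.integral_of_le ht.1]
    have hgw : Integrable fun s => g s (w s) := memLp_one_iff_integrable.1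
      ((ContinuousLinearMap.id ℝ (StrongDual ℝ V)).memLp_of_bilin 1 hg hw)
    refine setIntegral_mono_on_ae hgw.integrableOn
      ((continuous_const.mul hq).integrableOn_Ioc) measurableSet_Ioc ?_
    filter_upwards [hle] with s hs hst
    exact hs ⟨hst.1, hst.2.trans_lt ht.2⟩
  refine Lp.ext ?_
  filter_upwards [hWu₁, hWu₂, ae_restrict_mem measurableSet_Ioo] with s h1 h2 hs
  have h0 : W₁ s - W₂ s = 0 := by simpa [W] using hzero s ⟨hs.1.le, hs.2⟩
  rw [h1, h2] at h0
  exact hi.injective (sub_eq_zero.1 h0)
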